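/- Let $\mathcal V=(\mathcal V,\otimes,k)$ be a finite commutative unital quantale, i.e. a finite complete lattice with a commutative monoid structure such that each $u\otimes-$ preserves all joins. Let $\hom(u,-)$ be the right adjoint of $u\otimes -$ and $\hom_s(u,w)=\hom(u,w)\wedge\hom(w,u)$. A symmetric $\mathcal V$-category is a set $X$ with a map $a\colon X\times X\to\mathcal V$ such that $k\le a(x,x)$, $a(x,y)\otimes a(y,z)\le a(x,z)$ and $a(x,y)=a(y,x)$; a $\mathcal V$-functor $f\colon(X,a)\to(Y,b)$ is a map with $a(x,y)\le b(f(x),f(y))$ for all $x,y\in X$, and it is initial if $a(x,y)=b(f(x),f(y))$ for all $x,y\in X$. Let $\mathcal V\text{-}\mathbf{Cat}_{\mathrm{sym}}$ be the resulting category, with forgetful functor $|-|$ to $\mathbf{Set}$. Write $\mathcal V_s=(\mathcal V,\hom_s)$, and let $\mathcal V_s^n$ be its $n$-th power, with structure $[v,w]=\bigwedge_{i<n}\hom_s(v_i,w_i)$. Let $\mathsf G\colon\mathbf{Set}\to\mathbf{Set}$ be a finitary functor (for every set $X$, every $t\in \mathsf GX$ lies in the image of $\mathsf Gm$ for the inclusion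 $m\colon A\to X$ of some finite subset $A$), and let $\mathsf F\colon \mathcal V\text{-}\mathbf{Cat}_{\mathrm{sym}}\to\mathcal V\text{-}\mathbf{Cat}_{\mathrm{sym}}$ be a functor that lifts $\mathsf G$, i.e. $|-|\cdot\mathsf F=\mathsf G\cdot|-|$, and that preserves initial morphisms. For $n\in\mathbb N$, an $n$-ary predicate lifting for $\mathsf F$ is a natural transformation $\lambda\colon\mathcal V\text{-}\mathbf{Cat}_{\mathrm{sym}}(-,\mathcal V_s^n)\to\mathcal V\text{-}\mathbf{Cat}_{\mathrm{sym}}(\mathsf F-,\mathcal V_s)$. Given a set $\Lambda$ of predicate liftings of finite arity, $\mathcal L(\Lambda)$ is the set of formulas $$\phi::=\top\mid\phi_1\vee\phi_2\mid\phi_1\wedge\phi_2\mid u\otimes\phi\mid\hom_s(u,\phi)\mid\lambda(\phi_1,\dots,\phi_n)\qquad(u\in\mathcal V,\ \lambda\in\Lambda\ n\text{-ary}).$$ Over a coalgebra $\alpha\colon (X,a)\to\mathsf F(X,a)$, a formula is interpreted as a $\mathcal V$-functor $[\![\phi]\!]\colon(X,a)\to\mathcal V_s$: $\top$ is the constant map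 into $\top$, the propositional operators are interpreted pointwise by the operations of $\mathcal V$, and $[\![\lambda(\phi_1,\dots,\phi_n)]\!]=\lambda(\langle[\![\phi_1]\!],\dots,[\![\phi_n]\!]\rangle)\cdot\alpha$. Then there is a set $\Lambda$ of predicate liftings for $\mathsf F$ of finite arity such that $\mathcal L(\Lambda)$ is expressive: for every $\mathsf F$-coalgebra $\alpha\colon(X,a)\to\mathsf F(X,a)$ and all $x,y\in X$, $$\bigwedge_{\phi\in\mathcal L(\Lambda)}\hom_s\big([\![\phi]\!](x),[\![\phi]\!](y)\big)\ \le\ \bigvee\big\{b(f(x),f(y))\ \big|\ f\colon(X,a,\alpha)\to(Y,b,\beta)\text{ a morphism of }\mathsf F\text{-coalgebras}\big\}.$$ -/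

import Mathlib

open CategoryTheory

universe u

namespace QuantaleLogic

open Quantale

section

variable {V : Type u} [CommMonoid V] [CompleteLattice V] [IsQuantale V]

/-- The internal hom of a commutative quantale: `u * v ≤ w ↔ v ≤ ihom u w`. -/
def ihom (u w : V) : V := leftMulResiduation u w

theorem le_ihom {u v w : V} : v ≤ ihom u w ↔ u * v ≤ w := by
  rw [ihom, leftMulResiduation_le_iff_mul_le, mul_comm]

theorem mul_ihom_le (u w : V) : u * ihom u w ≤ w := le_ihom.1 le_rfl

/-- The symmetrized internal hom `hom_s(u, w) = hom(u, w) ∧ hom(w, u)`. -/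
def homS (u w : V) : V := ihom u w ⊓ ihom w u

theorem homS_comm (u w : V) : homS u w = homS w u := inf_comm _ _

theorem mul_homS_le (u w : V) : u * homS u w ≤ w :=
  (mul_le_mul_right inf_le_left u).trans (mul_ihom_le u w)

theorem mul_homS_le' (u w : V) : w * homS u w ≤ u := by
  rw [homS_comm]; exact mul_homS_le w u

theorem le_homS {u v w : V} : v ≤ homS u w ↔ u * v ≤ w ∧ w * v ≤ u := by
  rw [homS, le_inf_iff, le_ihom, le_ihom]

theorem one_le_homS (u : V) : 1 ≤ homS u u := le_homS.2 ⟨by simp, by simp⟩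

theorem homS_trans (u v w : V) : homS u v * homS v w ≤ homS u w := by
  refine le_homS.2 ⟨?_, ?_⟩
  · rw [← mul_assoc]
    exact (mul_le_mul_left (mul_homS_le u v) _).trans (mul_homS_le v w)
  · rw [mul_comm (homS u v), ← mul_assoc]
    exact (mul_le_mul_left (mul_homS_le' v w) _).trans (mul_homS_le' u v)

theorem homS_sup_le (u u' w w' : V) : homS u w ⊓ homS u' w' ≤ homS (u ⊔ u') (w ⊔ w') := by
  refine le_homS.2 ⟨?_, ?_⟩ <;> rw [sup_mul_distrib]
  · exact sup_le_sup ((mul_le_mul_right inf_le_left _).trans (mul_homS_le _ _))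
      ((mul_le_mul_right inf_le_right _).trans (mul_homS_le _ _))
  · exact sup_le_sup ((mul_le_mul_right inf_le_left _).trans (mul_homS_le' _ _))
      ((mul_le_mul_right inf_le_right _).trans (mul_homS_le' _ _))

theorem homS_inf_le (u u' w w' : V) : homS u w ⊓ homS u' w' ≤ homS (u ⊓ u') (w ⊓ w') := by
  refine le_homS.2 ⟨le_inf ?_ ?_, le_inf ?_ ?_⟩
  · exact (mul_le_mul' inf_le_left inf_le_left).trans (mul_homS_le _ _)
  · exact (mul_le_mul' inf_le_right inf_le_right).trans (mul_homS_le _ _)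
  · exact (mul_le_mul' inf_le_left inf_le_left).trans (mul_homS_le' _ _)
  · exact (mul_le_mul' inf_le_right inf_le_right).trans (mul_homS_le' _ _)

theorem homS_mul_le (c u w : V) : homS u w ≤ homS (c * u) (c * w) := by
  refine le_homS.2 ⟨?_, ?_⟩ <;> rw [mul_assoc]
  · exact mul_le_mul_right (mul_homS_le _ _) c
  · exact mul_le_mul_right (mul_homS_le' _ _) c

theorem homS_homS_le (c u w : V) : homS u w ≤ homS (homS c u) (homS c w) := by
  refine le_homS.2 ⟨homS_trans c u w, ?_⟩
  rw [homS_comm u w]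
  exact homS_trans c w u

end

/-- A symmetric `V`-category, for a commutative unital quantale `V` with tensor `*` and
unit `1`. -/
structure SymVCat (V : Type u) [CommMonoid V] [CompleteLattice V] where
  carrier : Type u
  dist : carrier → carrier → V
  one_le_dist_self : ∀ x, 1 ≤ dist x x
  dist_mul_dist_le : ∀ x y z, dist x y * dist y z ≤ dist x z
  dist_symm : ∀ x y, dist x y = dist y x

section

variable {V : Type u} [CommMonoid V] [CompleteLattice V]

/-- `V`-functors. -/
@[ext]
structure VFunctor (X Y : SymVCat V) where
  toFun : X.carrier → Y.carrier
  dist_le : ∀ x y, X.dist x y ≤ Y.dist (toFun x) (toFun y)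

instance : Category.{u} (SymVCat V) where
  Hom X Y := VFunctor X Y
  id X := ⟨fun x => x, fun _ _ => le_rfl⟩
  comp f g := ⟨fun x => g.toFun (f.toFun x),
    fun x y => (f.dist_le x y).trans (g.dist_le _ _)⟩

/-- The forgetful functor from symmetric `V`-categories to sets. -/
def forgetful (V : Type u) [CommMonoid V] [CompleteLattice V] : SymVCat V ⥤ Type u where
  obj X := X.carrier
  map f := ↾(VFunctor.toFun f)

/-- A `V`-functor is initial if its domain carries the initial structure. -/
def IsInitialMorphism {X Y : SymVCat V} (f : X ⟶ Y) : Prop :=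
  ∀ x y, X.dist x y = Y.dist (f.toFun x) (f.toFun y)

def PreservesInitialMorphisms (F : SymVCat V ⥤ SymVCat V) : Prop :=
  ∀ ⦃X Y : SymVCat V⦄ (f : X ⟶ Y), IsInitialMorphism f → IsInitialMorphism (F.map f)

/-- `F` is a lifting of the endofunctor `G` of the category of sets. -/
def IsLifting (F : SymVCat V ⥤ SymVCat V) (G : Type u ⥤ Type u) : Prop :=
  F ⋙ forgetful V = forgetful V ⋙ G

end

/-- A set functor is finitary if every `x ∈ G X` lies in the image of `G m` for the inclusion
`m : A → X` of some finite subset `A` of `X`. -/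
def IsFinitary (G : Type u ⥤ Type u) : Prop :=
  ∀ (X : Type u) (x : G.obj X), ∃ A : Set X, A.Finite ∧
    ∃ y : G.obj A, G.map (↾(Subtype.val : A → X)) y = x

section

variable (V : Type u) [CommMonoid V] [CompleteLattice V] [IsQuantale V]

/-- The symmetric `V`-category `V_s = (V, hom_s)`. -/
def truthObj : SymVCat V where
  carrier := V
  dist := homS
  one_le_dist_self := one_le_homS
  dist_mul_dist_le := homS_trans
  dist_symm := homS_comm

end

section

variable {V : Type u} [CommMonoid V] [CompleteLattice V] [IsQuantale V]

/-- A `V`-functor into `V_s` from its underlying map. -/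
def predicate {X : SymVCat V} (f : X.carrier → V)
    (h : ∀ x y, X.dist x y ≤ homS (f x) (f y)) : X ⟶ truthObj V := ⟨f, h⟩

/-- The value of a `V_s`-valued `V`-functor at a point. -/
def val {X : SymVCat V} (f : X ⟶ truthObj V) (x : X.carrier) : V := f.toFun x

theorem dist_le_val {X : SymVCat V} (f : X ⟶ truthObj V) (x y : X.carrier) :
    X.dist x y ≤ homS (val f x) (val f y) := f.dist_le x y

/-- The `n`-th power of a symmetric `V`-category. -/
def power (X : SymVCat V) (n : ℕ) : SymVCat V where
  carrier := Fin n → X.carrier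
  dist f g := ⨅ i, X.dist (f i) (g i)
  one_le_dist_self f := le_iInf fun i => X.one_le_dist_self (f i)
  dist_mul_dist_le _ _ _ := le_iInf fun i =>
    (mul_le_mul' (iInf_le _ i) (iInf_le _ i)).trans (X.dist_mul_dist_le _ _ _)
  dist_symm _ _ := iInf_congr fun _ => X.dist_symm _ _

/-- The `V`-functor `⟨f₁, …, fₙ⟩ : X → Yⁿ`. -/
def tuple {X Y : SymVCat V} {n : ℕ} (f : Fin n → (X ⟶ Y)) : X ⟶ power Y n where
  toFun x i := (f i).toFun x
  dist_le x y := le_iInf fun i => (f i).dist_le x y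

/-- `n`-ary predicate liftings for `F`: natural transformations from `Hom(-, V_sⁿ)` to
`Hom(F -, V_s)`. -/
abbrev PredLifting (F : SymVCat V ⥤ SymVCat V) (n : ℕ) :=
  yoneda.obj (power (truthObj V) n) ⟶ F.op ⋙ yoneda.obj (truthObj V)

/-- Predicate liftings for `F` of finite arity, together with their arity. -/
abbrev FinPredLifting (F : SymVCat V ⥤ SymVCat V) := Σ n : ℕ, PredLifting F n

/-- The component of a predicate lifting at `X`. -/
def PredLifting.at {F : SymVCat V ⥤ SymVCat V} {n : ℕ} (l : PredLifting F n)
    {X : SymVCat V} (f : X ⟶ power (truthObj V) n) : F.obj X ⟶ truthObj V :=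
  l.app (Opposite.op X) f

/-- The formulas of the quantitative coalgebraic modal logic with modalities `Λ`. -/
inductive Formula {F : SymVCat V ⥤ SymVCat V} (Λ : Set (FinPredLifting F)) : Type (u + 1)
  | top : Formula Λ
  | sup : Formula Λ → Formula Λ → Formula Λ
  | inf : Formula Λ → Formula Λ → Formula Λ
  | tensor : V → Formula Λ → Formula Λ
  | hom : V → Formula Λ → Formula Λ
  | modal : (l : Λ) → (Fin l.1.1 → Formula Λ) → Formula Λ

/-- The interpretation of a formula over a coalgebra `C`, a `V`-functor `C → V_s`. -/
def Formula.sem {F : SymVCat V ⥤ SymVCat V} {Λ : Set (FinPredLifting F)}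
    (C : Endofunctor.Coalgebra F) : Formula Λ → (C.V ⟶ truthObj V)
  | top => predicate (fun _ => ⊤) fun _ _ => le_homS.2 ⟨le_top, le_top⟩
  | sup φ ψ => predicate (fun x => val (φ.sem C) x ⊔ val (ψ.sem C) x) fun x y =>
      (le_inf (dist_le_val (φ.sem C) x y) (dist_le_val (ψ.sem C) x y)).trans
        (homS_sup_le _ _ _ _)
  | inf φ ψ => predicate (fun x => val (φ.sem C) x ⊓ val (ψ.sem C) x) fun x y =>
      (le_inf (dist_le_val (φ.sem C) x y) (dist_le_val (ψ.sem C) x y)).trans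
        (homS_inf_le _ _ _ _)
  | tensor u φ => predicate (fun x => u * val (φ.sem C) x) fun x y =>
      (dist_le_val (φ.sem C) x y).trans (homS_mul_le _ _ _)
  | hom u φ => predicate (fun x => homS u (val (φ.sem C) x)) fun x y =>
      (dist_le_val (φ.sem C) x y).trans (homS_homS_le _ _ _)
  | modal l φs => C.str ≫ PredLifting.at l.1.2 (tuple fun i => (φs i).sem C)

/-- Logical distance on a coalgebra. -/
def logicalDist {F : SymVCat V ⥤ SymVCat V} (Λ : Set (FinPredLifting F))
    (C : Endofunctor.Coalgebra F) (x y : C.V.carrier) : V :=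
  ⨅ φ : Formula Λ, homS (val (φ.sem C) x) (val (φ.sem C) y)

/-- Behavioural distance on a coalgebra: the join of the distances of the images of `x` and `y`
over all coalgebra morphisms out of `C`. -/
def behaviouralDist {F : SymVCat V ⥤ SymVCat V}
    (C : Endofunctor.Coalgebra F) (x y : C.V.carrier) : V :=
  ⨆ (D : Endofunctor.Coalgebra F) (f : C ⟶ D), D.V.dist (f.f.toFun x) (f.f.toFun y)

/-- The coalgebraic logic with modalities `Λ` is expressive. -/
def IsExpressive {F : SymVCat V ⥤ SymVCat V} (Λ : Set (FinPredLifting F)) : Prop :=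
  ∀ (C : Endofunctor.Coalgebra F) (x y : C.V.carrier),
    logicalDist Λ C x y ≤ behaviouralDist C x y

end

end QuantaleLogic

namespace QuantaleLogic

section

variable {V : Type u} [CommMonoid V] [CompleteLattice V]

/-! All finitary predicate liftings together suffice. The state space is re-equipped with its
logical distance; once the transition map remains a `V`-functor into `F` of this new space
(`logicalDist_le_dist_map_toLogicalSpace`), the identity is a coalgebra morphism, and the logical
distance is one of the terms joined in the behavioural distance.

Since `G` is finitary, two successors live over a finite subset `A`. Since `V` is finite, finitely
many formulas already induce the logical distance on `A`, that is, an initial map into a power of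
`V_s`. As `F` preserves initiality, the successor distance can be computed in `F` of that power,
where representables, read as predicate liftings by Yoneda, detect it. -/

theorem map_comp_toFun (F : SymVCat V ⥤ SymVCat V) {X Y Z : SymVCat V} (f : X ⟶ Y) (g : Y ⟶ Z)
    (p : (F.obj X).carrier) :
    (F.map (f ≫ g)).toFun p = (F.map g).toFun ((F.map f).toFun p) :=
  congrArg (fun h : F.obj X ⟶ F.obj Z => h.toFun p) (F.map_comp f g)

/-- The initial structure on a subset of a symmetric `V`-category. -/
def SymVCat.sub (X : SymVCat V) (A : Set X.carrier) : SymVCat V where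
  carrier := A
  dist x y := X.dist x y
  one_le_dist_self x := X.one_le_dist_self x
  dist_mul_dist_le x y z := X.dist_mul_dist_le x y z
  dist_symm x y := X.dist_symm x y

/-- The inclusion of a subset as a `V`-functor. -/
def SymVCat.incl (X : SymVCat V) (A : Set X.carrier) : X.sub A ⟶ X :=
  ⟨Subtype.val, fun _ _ => le_rfl⟩

theorem SymVCat.isInitialMorphism_incl (X : SymVCat V) (A : Set X.carrier) :
    IsInitialMorphism (X.incl A) := fun _ _ => rfl

/-- The inclusion between two subsets as a `V`-functor. -/
def SymVCat.inclusion (X : SymVCat V) {A B : Set X.carrier} (h : A ⊆ B) :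
    X.sub A ⟶ X.sub B :=
  ⟨Set.inclusion h, fun _ _ => le_rfl⟩

theorem IsLifting.exists_finite {F : SymVCat V ⥤ SymVCat V} {G : Type u ⥤ Type u}
    (hF : IsLifting F G) (hG : IsFinitary G) (X : SymVCat V) (p : (F.obj X).carrier) :
    ∃ A : Set X.carrier, A.Finite ∧ ∃ s, (F.map (X.incl A)).toFun s = p := by
  let e : F ⋙ forgetful V ≅ forgetful V ⋙ G := eqToIso hF
  obtain ⟨A, hA, y, hy⟩ := hG X.carrier (e.hom.app X p)
  refine ⟨A, hA, e.inv.app (X.sub A) y, ?_⟩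
  have h := ConcreteCategory.congr_hom (e.inv.naturality (X.incl A)) y
  have h' : e.inv.app X (G.map (↾(Subtype.val : A → X.carrier)) y) =
      (F.map (X.incl A)).toFun (e.inv.app (X.sub A) y) := h
  rw [← h', hy]
  exact ConcreteCategory.congr_hom (e.hom_inv_id_app X) p

theorem IsLifting.exists_finite_pair {F : SymVCat V ⥤ SymVCat V} {G : Type u ⥤ Type u}
    (hF : IsLifting F G) (hG : IsFinitary G) (X : SymVCat V) (p q : (F.obj X).carrier) :
    ∃ A : Set X.carrier, A.Finite ∧
      ∃ s t, (F.map (X.incl A)).toFun s = p ∧ (F.map (X.incl A)).toFun t = q := by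
  obtain ⟨A, hA, s, hs⟩ := hF.exists_finite hG X p
  obtain ⟨B, hB, t, ht⟩ := hF.exists_finite hG X q
  refine ⟨A ∪ B, hA.union hB,
    (F.map (X.inclusion Set.subset_union_left)).toFun s,
    (F.map (X.inclusion Set.subset_union_right)).toFun t, ?_, ?_⟩
  · rw [← map_comp_toFun]; exact hs
  · rw [← map_comp_toFun]; exact ht

end

section

variable {V : Type u} [CommMonoid V] [CompleteLattice V] [IsQuantale V]

/-- The representable `V`-functor `X(p, -) : X → V_s`. -/
def representable (X : SymVCat V) (p : X.carrier) : X ⟶ truthObj V :=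
  predicate (X.dist p) fun x y => le_homS.2
    ⟨X.dist_mul_dist_le p x y, by rw [X.dist_symm x y]; exact X.dist_mul_dist_le p y x⟩

/-- The reflexivity bound `1 ≤ X.dist p p` makes the single predicate `X(p, -)` enough to bound the
distance from `p`. -/
theorem homS_representable_le (X : SymVCat V) (p q : X.carrier) :
    homS (X.dist p p) (X.dist p q) ≤ X.dist p q :=
  calc homS (X.dist p p) (X.dist p q) = 1 * homS (X.dist p p) (X.dist p q) := (one_mul _).symm
    _ ≤ X.dist p p * homS (X.dist p p) (X.dist p q) :=
      mul_le_mul_left (X.one_le_dist_self p) _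
    _ ≤ X.dist p q := mul_homS_le _ _

variable {F : SymVCat V ⥤ SymVCat V}

/-- The predicate lifting with a given action on the identity of `V_sⁿ`. -/
def PredLifting.ofEval {n : ℕ} (g : F.obj (power (truthObj V) n) ⟶ truthObj V) :
    PredLifting F n :=
  yonedaEquiv.symm g

theorem PredLifting.ofEval_at {n : ℕ} (g : F.obj (power (truthObj V) n) ⟶ truthObj V)
    {X : SymVCat V} (f : X ⟶ power (truthObj V) n) :
    (PredLifting.ofEval g).at f = F.map f ≫ g := rfl

/-- By Yoneda, an `n`-ary lifting is a `V`-functor `F(V_sⁿ) → V_s`, so all liftings together form a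
genuine set. -/
theorem small_finPredLifting : Small.{u} (FinPredLifting F) :=
  small_map (β := Σ n : ℕ, (F.obj (power (truthObj V) n) ⟶ truthObj V))
    (Equiv.sigmaCongrRight fun _ => yonedaEquiv)

section

variable (Λ : Set (FinPredLifting F)) (C : Endofunctor.Coalgebra F)

/-- The state space of a coalgebra, equipped with the logical distance. -/
def logicalSpace : SymVCat V where
  carrier := C.V.carrier
  dist := logicalDist Λ C
  one_le_dist_self _ := le_iInf fun _ => one_le_homS _
  dist_mul_dist_le _ _ _ := le_iInf fun φ =>
    (mul_le_mul' (iInf_le _ φ) (iInf_le _ φ)).trans (homS_trans _ _ _)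
  dist_symm _ _ := iInf_congr fun _ => homS_comm _ _

/-- The identity map, as a `V`-functor into the logical distance. -/
def toLogicalSpace : C.V ⟶ logicalSpace Λ C :=
  ⟨fun x => x, fun x y => le_iInf fun φ => dist_le_val (φ.sem C) x y⟩

variable {Λ}

/-- The semantics of a formula, as a `V`-functor on the logical distance. -/
def Formula.logicalSem (φ : Formula Λ) : logicalSpace Λ C ⟶ truthObj V :=
  predicate (fun x => val (φ.sem C) x) fun _ _ => iInf_le _ φ

theorem exists_isInitialMorphism_tuple [Finite V] {A : Set C.V.carrier} (hA : A.Finite) :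
    ∃ (n : ℕ) (φ : Fin n → Formula Λ), IsInitialMorphism
      ((logicalSpace Λ C).incl A ≫ tuple fun i => (φ i).logicalSem C) := by
  have : Finite A := hA
  let r : Formula Λ → A → V := fun φ a => val (φ.sem C) a
  -- There are only finitely many functions `A → V`, so one formula for each function that occurs
  -- represents all formulas on `A`.
  obtain ⟨n, ⟨e⟩⟩ := Finite.exists_equiv_fin (Set.range r)
  choose φ hφ using fun i : Fin n => (e.symm i).2
  refine ⟨n, φ, fun x y => le_antisymm (VFunctor.dist_le _ x y) (le_iInf fun ψ => ?_)⟩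
  have h : r (φ (e ⟨r ψ, ψ, rfl⟩)) = r ψ := by rw [hφ, Equiv.symm_apply_apply]
  have hx : val (ψ.sem C) x.1 = val ((φ (e ⟨r ψ, ψ, rfl⟩)).sem C) x.1 := (congrFun h x).symm
  have hy : val (ψ.sem C) y.1 = val ((φ (e ⟨r ψ, ψ, rfl⟩)).sem C) y.1 := (congrFun h y).symm
  rw [hx, hy]
  exact iInf_le (fun i => homS (val ((φ i).sem C) x.1) (val ((φ i).sem C) y.1)) _

end

theorem logicalDist_le_dist_map_tuple (C : Endofunctor.Coalgebra F) {n : ℕ}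
    (φ : Fin n → Formula (Set.univ : Set (FinPredLifting F))) (x y : C.V.carrier) :
    logicalDist Set.univ C x y ≤ (F.obj (power (truthObj V) n)).dist
      ((F.map (tuple fun i => (φ i).sem C)).toFun (C.str.toFun x))
      ((F.map (tuple fun i => (φ i).sem C)).toFun (C.str.toFun y)) := by
  refine le_trans ?_ (homS_representable_le _ _ _)
  -- The modality represents the image `p` of the successor of `x`; the formula takes the value
  -- `dist p p` at `x` and `dist p q` at `y`, with `q` the image of the successor of `y`.
  exact iInf_le _ (Formula.modal ⟨⟨n, PredLifting.ofEval (representable _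
    ((F.map (tuple fun i => (φ i).sem C)).toFun (C.str.toFun x)))⟩, Set.mem_univ _⟩ φ)

theorem logicalDist_le_dist_map_toLogicalSpace [Finite V] {G : Type u ⥤ Type u}
    (hG : IsFinitary G) (hF : IsLifting F G) (hinit : PreservesInitialMorphisms F)
    (C : Endofunctor.Coalgebra F) (x y : C.V.carrier) :
    logicalDist Set.univ C x y ≤ (F.obj (logicalSpace Set.univ C)).dist
      ((F.map (toLogicalSpace Set.univ C)).toFun (C.str.toFun x))
      ((F.map (toLogicalSpace Set.univ C)).toFun (C.str.toFun y)) := by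
  obtain ⟨A, hA, s, t, hs, ht⟩ := hF.exists_finite_pair hG (logicalSpace Set.univ C)
    ((F.map (toLogicalSpace Set.univ C)).toFun (C.str.toFun x))
    ((F.map (toLogicalSpace Set.univ C)).toFun (C.str.toFun y))
  obtain ⟨n, φ, hφ⟩ := exists_isInitialMorphism_tuple (Λ := Set.univ) C hA
  refine (logicalDist_le_dist_map_tuple C φ x y).trans (le_of_eq ?_)
  have key : (tuple fun i => (φ i).sem C) =
      toLogicalSpace Set.univ C ≫ tuple fun i => (φ i).logicalSem C := rfl
  -- The tuple is known to be initial only on `A`, so both sides are pulled back to the distance of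
  -- `s` and `t` in `F` of the subspace `A`.
  rw [key, map_comp_toFun, map_comp_toFun, ← hs, ← ht, ← map_comp_toFun, ← map_comp_toFun,
    ← hinit _ hφ, ← hinit _ ((logicalSpace Set.univ C).isInitialMorphism_incl A)]

/-- The coalgebra on the logical distance with the same underlying map as the given coalgebra. -/
def logicalCoalgebra (C : Endofunctor.Coalgebra F) (Λ : Set (FinPredLifting F))
    (h : ∀ x y, logicalDist Λ C x y ≤ (F.obj (logicalSpace Λ C)).dist
      ((F.map (toLogicalSpace Λ C)).toFun (C.str.toFun x))
      ((F.map (toLogicalSpace Λ C)).toFun (C.str.toFun y))) :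
    Endofunctor.Coalgebra F where
  V := logicalSpace Λ C
  str := ⟨fun x => (F.map (toLogicalSpace Λ C)).toFun (C.str.toFun x), h⟩

theorem isExpressive_univ [Finite V] {G : Type u ⥤ Type u}
    (hG : IsFinitary G) (hF : IsLifting F G) (hinit : PreservesInitialMorphisms F) :
    IsExpressive (Set.univ : Set (FinPredLifting F)) := by
  intro C x y
  let D := logicalCoalgebra C Set.univ
    (logicalDist_le_dist_map_toLogicalSpace hG hF hinit C)
  -- The structure of `D` was defined as the composite that this square demands.
  let f : C ⟶ D := { f := toLogicalSpace Set.univ C, h := rfl }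
  exact le_iSup₂ (f := fun (D : Endofunctor.Coalgebra F) (f : C ⟶ D) =>
    D.V.dist (f.f.toFun x) (f.f.toFun y)) D f

end

end QuantaleLogic

theorem mainTheorem5 (V : Type u) [CommMonoid V] [CompleteLattice V] [IsQuantale V] [Finite V]
    (G : Type u ⥤ Type u) (hG : QuantaleLogic.IsFinitary G)
    (F : QuantaleLogic.SymVCat V ⥤ QuantaleLogic.SymVCat V)
    (hF : QuantaleLogic.IsLifting F G)
    (hinit : QuantaleLogic.PreservesInitialMorphisms F) :
    ∃ Λ : Set (QuantaleLogic.FinPredLifting F),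
      Small.{u} Λ ∧ QuantaleLogic.IsExpressive Λ := by
  have := QuantaleLogic.small_finPredLifting (F := F)
  exact ⟨Set.univ, inferInstance, QuantaleLogic.isExpressive_univ hG hF hinit⟩
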